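/- Let $q$ be a complex number with $|q|<1$. For $a\in\mathbb{C}$ and $|p|<1$ write $(a;p)_n=\prod_{j=1}^{n}(1-ap^{j-1})$ for $n\ge 0$ (so $(a;p)_0=1$), $(a;p)_\infty=\prod_{n=0}^{\infty}(1-ap^n)$, $(a,b,c;p)_\infty=(a;p)_\infty(b;p)_\infty(c;p)_\infty$, and $(q)_n=(q;q)_n$, $(q)_\infty=(q;q)_\infty$. For integers $0\le k\le N$ let ${N\brack k}=\frac{(q)_N}{(q)_k(q)_{N-k}}$ be the $q$-binomial coefficient. Then the following series (over $n$, with finite inner sums over integers $m$) converges absolutely, and $$1+\sum_{n=1}^{\infty}\ \sum_{m=-\lfloor\frac{n-1}{2}\rfloor}^{\lfloor\frac{n}{2}\rfloor}\frac{(-1)^m q^{n(n+1)+m(5m-3)/2}(1+q^m)}{(q)_{2n}}{2n-1\brack n-2m}=\frac{1}{(q)_\infty}\Big((q^5,q^8,q^{13};q^{13})_\infty-q\,(q,q^{12},q^{13};q^{13})_\infty\Big).$$ (For $q=0$ every summand on the left with $n\ge1$ is read as $0$, its value as a power series in $q$ without constant term.) -/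

import Mathlib

open Finset

noncomputable section

/-- The finite `q`-shifted factorial `(a;q)_n = ∏_{j=1}^{n} (1 - a q^{j-1})`. -/
def qPoch (a q : ℂ) (n : ℕ) : ℂ := ∏ j ∈ Finset.range n, (1 - a * q ^ j)

/-- The infinite `q`-shifted factorial `(a;q)_∞ = ∏_{n ≥ 0} (1 - a q^n)`. -/
def qPochInf (a q : ℂ) : ℂ := ∏' n : ℕ, (1 - a * q ^ n)

/-- `(a, b, c; q)_∞ = (a;q)_∞ (b;q)_∞ (c;q)_∞`. -/
def qPochInf₃ (a b c q : ℂ) : ℂ := qPochInf a q * qPochInf b q * qPochInf c q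

/-- The Gaussian binomial coefficient `[n brack k]_q = (q;q)_n / ((q;q)_k (q;q)_{n-k})` for
`0 ≤ k ≤ n`, and `0` for every other integer `k`. -/
def qBinom (q : ℂ) (n : ℕ) (k : ℤ) : ℂ :=
  if 0 ≤ k ∧ k ≤ n then
    qPoch q q n / (qPoch q q k.toNat * qPoch q q (n - k.toNat))
  else 0

/-- The infinite product defining `(a;q)_∞` converges for `|q| < 1`. -/
theorem multipliable_qPochInf (a : ℂ) {q : ℂ} (hq : ‖q‖ < 1) :
    Multipliable fun n : ℕ => 1 - a * q ^ n := by
  have h : Summable fun n : ℕ => ‖-(a * q ^ n)‖ := by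
    simp only [norm_neg, norm_mul, norm_pow]
    exact (summable_geometric_of_lt_one (norm_nonneg q) hq).mul_left _
  simpa [sub_eq_add_neg] using multipliable_one_add_of_summable h

/-- The `(n, m)` summand
`(-1)^m q^{n(n+1) + m(5m-3)/2} (1 + q^m) / (q;q)_{2n} * [2n-1 brack n-2m]_q`, for `n ≥ 1`.
The integer `m(5m-3)` is always even, so that the division by `2` in the exponent is exact. -/
def doubleSumTerm (q : ℂ) (n : ℕ+) (m : ℤ) : ℂ :=
  (-1) ^ m * q ^ ((n : ℤ) * (n + 1) + m * (5 * m - 3) / 2) * (1 + q ^ m)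
    / qPoch q q (2 * (n : ℕ)) * qBinom q (2 * (n : ℕ) - 1) ((n : ℤ) - 2 * m)

/-- The exponent `m(5m-3)/2` is an integer. -/
theorem two_dvd_exponent (m : ℤ) : 2 ∣ m * (5 * m - 3) := by
  rcases Int.even_or_odd' m with ⟨k, rfl | rfl⟩
  · exact ⟨k * (5 * (2 * k) - 3), by ring⟩
  · exact ⟨(2 * k + 1) * (5 * k + 1), by ring⟩

end

open Filter Topology

noncomputable section


/-! For fixed `n`, the terms `m` and `-m` combine into a difference of `T_m = (-1)^m q^{m(m+1)/2}`
times a kernel at `s = 2m`. The kernel's own differences are closed products, so summation by parts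
rewrites the inner sum as `∑_r T_{⌊r/2⌋} q^{r(r-1)/2} (1 - q^{2r+1}) / ((q)_{n-r} (q)_{n+r+1})`, in
effect a Bailey pair relative to `a = q`.

With `k = n - r` one has `n² + n = (r² + r) + k² + (2r+1)k`. After exchanging sums, Cauchy's
identity (`cauchySum_eq` with `c = 2r+1`) evaluates every sum over `k` to `1/(q)_∞`, independently
of `r`. The remaining series in `r`, split by parity, gives two theta series with base `q^13`, which
the Jacobi triple product (`tsum_thetaCoeff`) turns into products. -/

/-! ### The reciprocal of `(q;q)_n`, extended by zero to negative `n` -/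

/-- `1 / (q;q)_n` for `n ≥ 0`, and `0` for `n < 0`. -/
def invPoch (q : ℂ) (n : ℤ) : ℂ := if 0 ≤ n then (qPoch q q n.toNat)⁻¹ else 0

theorem invPoch_natCast (q : ℂ) (n : ℕ) : invPoch q n = (qPoch q q n)⁻¹ := by
  simp [invPoch]

theorem invPoch_of_neg (q : ℂ) {n : ℤ} (hn : n < 0) : invPoch q n = 0 := by
  simp [invPoch, hn]

theorem one_sub_pow_ne_zero {q : ℂ} (hq : ‖q‖ < 1) {n : ℕ} (hn : n ≠ 0) : 1 - q ^ n ≠ 0 := by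
  intro h
  have h1 : ‖q ^ n‖ < 1 := by
    rw [norm_pow]; exact pow_lt_one₀ (norm_nonneg q) hq hn
  rw [← sub_eq_zero.1 h] at h1
  simp at h1

theorem one_add_pow_ne_zero {q : ℂ} (hq : ‖q‖ < 1) {n : ℕ} (hn : n ≠ 0) : 1 + q ^ n ≠ 0 := by
  intro h
  have h1 : ‖q ^ n‖ < 1 := by
    rw [norm_pow]; exact pow_lt_one₀ (norm_nonneg q) hq hn
  rw [← neg_eq_of_add_eq_zero_right h] at h1
  simp at h1

theorem qPoch_succ (a q : ℂ) (n : ℕ) : qPoch a q (n + 1) = qPoch a q n * (1 - a * q ^ n) :=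
  Finset.prod_range_succ _ _

theorem qPoch_self_ne_zero {q : ℂ} (hq : ‖q‖ < 1) (n : ℕ) : qPoch q q n ≠ 0 := by
  refine Finset.prod_ne_zero_iff.2 fun j _ => ?_
  rw [← pow_succ']
  exact one_sub_pow_ne_zero hq j.succ_ne_zero

/-- Extension by zero makes this hold for every integer `n`: at `n = 0` the factor `1 - q^0`
vanishes. Hence no boundary cases arise in the sums below. -/
theorem invPoch_sub_one {q : ℂ} (hq : ‖q‖ < 1) (n : ℤ) :
    invPoch q (n - 1) = (1 - q ^ n) * invPoch q n := by
  rcases lt_trichotomy n 0 with hn | rfl | hn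
  · rw [invPoch_of_neg q hn, invPoch_of_neg q (by omega), mul_zero]
  · simp [invPoch]
  · obtain ⟨k, rfl⟩ : ∃ k : ℕ, n = ((k + 1 : ℕ) : ℤ) := ⟨(n - 1).toNat, by omega⟩
    rw [show ((k + 1 : ℕ) : ℤ) - 1 = (k : ℤ) by push_cast; ring, invPoch_natCast, invPoch_natCast,
      qPoch_succ, zpow_natCast, ← pow_succ', mul_inv]
    have := one_sub_pow_ne_zero hq k.succ_ne_zero
    field_simp

theorem tendsto_qPoch (a : ℂ) {q : ℂ} (hq : ‖q‖ < 1) :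
    Tendsto (qPoch a q) atTop (𝓝 (qPochInf a q)) :=
  (multipliable_qPochInf a hq).tendsto_prod_tprod_nat

theorem qPochInf_self_ne_zero {q : ℂ} (hq : ‖q‖ < 1) : qPochInf q q ≠ 0 := by
  have h : Summable fun n : ℕ => ‖-(q * q ^ n)‖ := by
    simp only [norm_neg, norm_mul, norm_pow]
    exact (summable_geometric_of_lt_one (norm_nonneg q) hq).mul_left _
  have := tprod_one_add_ne_zero_of_summable (f := fun n : ℕ => -(q * q ^ n)) ?_ h
  · simpa [qPochInf, sub_eq_add_neg] using this
  · intro n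
    rw [← sub_eq_add_neg, ← pow_succ']
    exact one_sub_pow_ne_zero hq n.succ_ne_zero

theorem tendsto_invPoch {q : ℂ} (hq : ‖q‖ < 1) :
    Tendsto (invPoch q) atTop (𝓝 (qPochInf q q)⁻¹) := by
  rw [← Nat.map_cast_int_atTop, tendsto_map'_iff]
  exact ((tendsto_qPoch q hq).inv₀ (qPochInf_self_ne_zero hq)).congr fun n =>
    (invPoch_natCast q n).symm

theorem exists_norm_invPoch_le {q : ℂ} (hq : ‖q‖ < 1) :
    ∃ B : ℝ, 0 ≤ B ∧ ∀ n, ‖invPoch q n‖ ≤ B := by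
  have h := (tendsto_qPoch q hq).inv₀ (qPochInf_self_ne_zero hq)
  obtain ⟨B, hB⟩ := (Metric.isBounded_range_of_tendsto _ h).exists_norm_le
  have hB0 : 0 ≤ B := (norm_nonneg _).trans (hB _ ⟨0, rfl⟩)
  refine ⟨B, hB0, fun n => ?_⟩
  unfold invPoch
  split_ifs
  · exact hB _ ⟨_, rfl⟩
  · simpa using hB0

/-! ### Cauchy's identity -/

/-- The sum `∑_k q^{k² + ck} / ((q;q)_k (q;q)_{k+c})`. -/
def cauchySum (q : ℂ) (c : ℕ) : ℂ :=
  ∑' k : ℕ, q ^ (k ^ 2 + c * k) * invPoch q k * invPoch q (k + c)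

theorem norm_pow_le_norm_pow {q : ℂ} (hq : ‖q‖ < 1) {m n : ℕ} (h : m ≤ n) :
    ‖q ^ n‖ ≤ ‖q‖ ^ m := by
  rw [norm_pow]; exact pow_le_pow_of_le_one (norm_nonneg q) hq.le h

theorem norm_mul_mul_le {a b c : ℂ} {A B : ℝ} (hA : ‖a‖ ≤ A) (hb : ‖b‖ ≤ B)
    (hc : ‖c‖ ≤ B) : ‖a * b * c‖ ≤ A * (B * B) := by
  rw [norm_mul, norm_mul, mul_assoc]
  have := (norm_nonneg a).trans hA
  have := (norm_nonneg b).trans hb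
  gcongr

theorem norm_cauchySum_term_le {q : ℂ} (hq : ‖q‖ < 1) {B : ℝ} (hB : ∀ n, ‖invPoch q n‖ ≤ B)
    (c k : ℕ) :
    ‖q ^ (k ^ 2 + c * k) * invPoch q k * invPoch q (k + c)‖ ≤ ‖q‖ ^ k * (B * B) :=
  norm_mul_mul_le (norm_pow_le_norm_pow hq (by nlinarith [Nat.le_self_pow two_ne_zero k]))
    (hB _) (hB _)

theorem summable_norm_pow_mul {q : ℂ} (hq : ‖q‖ < 1) (B : ℝ) :
    Summable fun k : ℕ => ‖q‖ ^ k * B :=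
  (summable_geometric_of_lt_one (norm_nonneg q) hq).mul_right _

theorem summable_cauchySum {q : ℂ} (hq : ‖q‖ < 1) (c : ℕ) :
    Summable fun k : ℕ => q ^ (k ^ 2 + c * k) * invPoch q k * invPoch q (k + c) := by
  obtain ⟨B, -, hB⟩ := exists_norm_invPoch_le hq
  exact .of_norm_bounded (summable_norm_pow_mul hq _) (norm_cauchySum_term_le hq hB c)

theorem cauchySum_recurrence {q : ℂ} (hq : ‖q‖ < 1) (c : ℕ) :
    cauchySum q c - cauchySum q (c + 1) =
      q ^ (c + 1) * (cauchySum q (c + 2) - cauchySum q (c + 1)) := by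
  have h0 := summable_cauchySum hq c
  have h1 := summable_cauchySum hq (c + 1)
  have h2 := summable_cauchySum hq (c + 2)
  set g : ℕ → ℂ := fun k => q ^ (k ^ 2 + c * k) * (1 - q ^ k) * invPoch q k
    * invPoch q (k + c + 1) with hg
  -- Over the common factor `invPoch q (k + c + 1)` the bracket is `(1 - q^{k+c+1}) - q^k +
  -- q^{k+c+1} = 1 - q^k`. This kills the term `k = 0` of `g`, and shifting `k` then yields the sum
  -- for `c + 2`.
  have e1 : ∀ k : ℕ, q ^ (k ^ 2 + c * k) * invPoch q k * invPoch q (k + c)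
      - q ^ (k ^ 2 + (c + 1) * k) * invPoch q k * invPoch q (k + (c + 1 : ℕ))
      + q ^ (c + 1) * (q ^ (k ^ 2 + (c + 1) * k) * invPoch q k * invPoch q (k + (c + 1 : ℕ)))
      = g k := by
    intro k
    have := invPoch_sub_one hq ((k + c + 1 : ℕ) : ℤ)
    rw [zpow_natCast] at this
    push_cast at this ⊢
    rw [add_sub_cancel_right] at this
    rw [this, hg, ← add_assoc]
    ring
  have e2 : ∀ k : ℕ, g (k + 1)
      = q ^ (c + 1) * (q ^ (k ^ 2 + (c + 2) * k) * invPoch q k * invPoch q (k + (c + 2 : ℕ))) := by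
    intro k
    have := invPoch_sub_one hq ((k + 1 : ℕ) : ℤ)
    rw [zpow_natCast] at this
    push_cast at this
    rw [add_sub_cancel_right] at this
    simp only [hg]
    push_cast
    rw [this, show (k : ℤ) + 1 + c + 1 = k + (c + 2) by ring]
    ring
  have hgs : Summable g := by
    rw [← funext e1]
    exact (h0.sub h1).add (h1.mul_left _)
  have t1 : ∑' k, g k = cauchySum q c - cauchySum q (c + 1) + q ^ (c + 1) * cauchySum q (c + 1) := by
    simp only [← e1]
    rw [(h0.sub h1).tsum_add (h1.mul_left _), h0.tsum_sub h1, tsum_mul_left]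
    rfl
  have t2 : ∑' k, g k = q ^ (c + 1) * cauchySum q (c + 2) := by
    rw [hgs.tsum_eq_zero_add]
    simp only [e2]
    rw [tsum_mul_left]
    simp [hg, cauchySum]
  linear_combination t2 - t1

/-- The differences satisfy `D c = -q^{c+1} D (c+1)` and are bounded uniformly in `c`; iterating the
contraction by `‖q‖` forces them to vanish. -/
theorem cauchySum_succ {q : ℂ} (hq : ‖q‖ < 1) (c : ℕ) : cauchySum q (c + 1) = cauchySum q c := by
  obtain ⟨B, -, hB⟩ := exists_norm_invPoch_le hq
  set D : ℕ → ℂ := fun c => cauchySum q c - cauchySum q (c + 1) with hD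
  obtain ⟨M, hM⟩ : ∃ M, ∀ c, ‖D c‖ ≤ M := by
    refine ⟨∑' k : ℕ, ‖q‖ ^ k * (B * B) + ∑' k : ℕ, ‖q‖ ^ k * (B * B), fun c => ?_⟩
    have h : ∀ c, ‖cauchySum q c‖ ≤ ∑' k : ℕ, ‖q‖ ^ k * (B * B) := fun c =>
      tsum_of_norm_bounded (summable_norm_pow_mul hq _).hasSum (norm_cauchySum_term_le hq hB c)
    exact (norm_sub_le _ _).trans (add_le_add (h _) (h _))
  have hstep : ∀ c, ‖D c‖ ≤ ‖q‖ * ‖D (c + 1)‖ := by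
    intro c
    have : D c = -(q ^ (c + 1) * D (c + 1)) := by
      simp only [hD]
      linear_combination cauchySum_recurrence hq c
    rw [this, norm_neg, norm_mul]
    gcongr
    simpa using norm_pow_le_norm_pow hq (Nat.le_add_left 1 c)
  have hn : ∀ n, ‖D c‖ ≤ ‖q‖ ^ n * M := by
    suffices h : ∀ n c, ‖D c‖ ≤ ‖q‖ ^ n * M from fun n => h n c
    intro n
    induction n with
    | zero => simpa using hM
    | succ n ih =>
      intro c
      calc ‖D c‖ ≤ ‖q‖ * ‖D (c + 1)‖ := hstep c
        _ ≤ ‖q‖ * (‖q‖ ^ n * M) := by gcongr; exact ih _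
        _ = ‖q‖ ^ (n + 1) * M := by ring
  have hlim : Tendsto (fun n : ℕ => ‖q‖ ^ n * M) atTop (𝓝 0) := by
    simpa using (tendsto_pow_atTop_nhds_zero_of_lt_one (norm_nonneg q) hq).mul_const M
  have h0 : ‖D c‖ ≤ 0 := ge_of_tendsto' hlim hn
  exact (sub_eq_zero.1 (norm_le_zero_iff.1 h0)).symm

/-- The sum is constant in `c`, so it equals its limit as `c → ∞`, where only `k = 0` survives. -/
theorem cauchySum_eq {q : ℂ} (hq : ‖q‖ < 1) (c : ℕ) : cauchySum q c = (qPochInf q q)⁻¹ := by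
  obtain ⟨B, -, hB⟩ := exists_norm_invPoch_le hq
  have hconst : ∀ c, cauchySum q c = cauchySum q 0 := by
    intro c
    induction c with
    | zero => rfl
    | succ c ih => rw [cauchySum_succ hq, ih]
  have hlim : Tendsto (cauchySum q) atTop
      (𝓝 (∑' k : ℕ, if k = 0 then (qPochInf q q)⁻¹ else 0)) := by
    refine tendsto_tsum_of_dominated_convergence (summable_norm_pow_mul hq (B * B)) (fun k => ?_)
      (Eventually.of_forall fun c k => norm_cauchySum_term_le hq hB c k)
    have hr : Tendsto (fun c : ℕ => invPoch q (k + c)) atTop (𝓝 (qPochInf q q)⁻¹) :=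
      (tendsto_invPoch hq).comp
        (tendsto_atTop_add_const_left _ _ tendsto_natCast_atTop_atTop)
    rcases Nat.eq_zero_or_pos k with rfl | hk
    · simpa [invPoch, qPoch] using hr
    · have hp : Tendsto (fun c : ℕ => q ^ (k ^ 2 + c * k)) atTop (𝓝 0) :=
        (tendsto_pow_atTop_nhds_zero_of_norm_lt_one hq).comp <|
          tendsto_atTop_mono (fun c => (Nat.le_mul_of_pos_right c hk).trans (Nat.le_add_left _ _)) tendsto_id
      simpa [hk.ne'] using (hp.mul_const (invPoch q k)).mul hr
  rw [tsum_ite_eq] at hlim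
  rw [hconst]
  exact tendsto_nhds_unique tendsto_const_nhds (hlim.congr hconst)


/-! ### The Jacobi triple product -/

/-- The coefficients `(-1)^k p^{k(k-1)/2} x^k` of the Jacobi triple product. -/
def thetaCoeff (p x : ℂ) (k : ℤ) : ℂ := (-1) ^ k * p ^ (k * (k - 1) / 2) * x ^ k

theorem thetaCoeff_add_one {p x : ℂ} (hp : p ≠ 0) (hx : x ≠ 0) (k : ℤ) :
    thetaCoeff p x (k + 1) = -(p ^ k * x) * thetaCoeff p x k := by
  have h : (k + 1) * (k + 1 - 1) / 2 = k * (k - 1) / 2 + k := by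
    rw [show (k + 1) * (k + 1 - 1) = k * (k - 1) + k * 2 by ring,
      Int.add_mul_ediv_right _ _ two_ne_zero]
  rw [thetaCoeff, thetaCoeff, h, zpow_add₀ hp, zpow_add_one₀ hx,
    zpow_add_one₀ (neg_ne_zero.2 one_ne_zero)]
  ring

theorem thetaCoeff_neg {p x y : ℂ} (hp : p ≠ 0) (hxy : x * y = p) (k : ℤ) :
    thetaCoeff p x (-k) = thetaCoeff p y k := by
  have hx : x ≠ 0 := left_ne_zero_of_mul (hxy ▸ hp)
  have h : -k * (-k - 1) / 2 = k * (k - 1) / 2 + k := by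
    rw [show -k * (-k - 1) = k * (k - 1) + k * 2 by ring,
      Int.add_mul_ediv_right _ _ two_ne_zero]
  rw [thetaCoeff, thetaCoeff, h, zpow_add₀ hp, ← inv_zpow' (-1 : ℂ), zpow_neg]
  nth_rw 2 [← hxy]
  rw [mul_zpow]
  have := zpow_ne_zero k hx
  norm_num
  field_simp

theorem summable_thetaCoeff_nat {p x : ℂ} (hp1 : ‖p‖ < 1) (hp : p ≠ 0) (hx : x ≠ 0) :
    Summable fun k : ℕ => ‖thetaCoeff p x k‖ := by
  have hne : ∀ k : ℕ, ‖thetaCoeff p x k‖ ≠ 0 := fun k => by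
    simp [thetaCoeff, zpow_ne_zero, hp, hx]
  refine summable_of_ratio_test_tendsto_lt_one zero_lt_one (.of_forall hne) ?_
  have h : ∀ k : ℕ, ‖‖thetaCoeff p x (k + 1 : ℕ)‖‖ / ‖‖thetaCoeff p x k‖‖ = ‖p‖ ^ k * ‖x‖ := by
    intro k
    rw [norm_norm, norm_norm]
    push_cast
    rw [thetaCoeff_add_one hp hx, norm_mul, mul_div_cancel_right₀ _ (hne k)]
    simp
  simp only [h]
  simpa using (tendsto_pow_atTop_nhds_zero_of_lt_one (norm_nonneg p) hp1).mul_const ‖x‖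

theorem summable_thetaCoeff {p x y : ℂ} (hp1 : ‖p‖ < 1) (hp : p ≠ 0) (hxy : x * y = p) :
    Summable fun k : ℤ => ‖thetaCoeff p x k‖ := by
  have hx : x ≠ 0 := left_ne_zero_of_mul (hxy ▸ hp)
  have hy : y ≠ 0 := right_ne_zero_of_mul (hxy ▸ hp)
  refine .of_nat_of_neg (summable_thetaCoeff_nat hp1 hp hx) ?_
  simpa only [thetaCoeff_neg hp hxy] using summable_thetaCoeff_nat hp1 hp hy

/-- The sum `∑_k (-1)^k p^{k(k-1)/2} x^k / ((p;p)_{N-k} (p;p)_{N+k})`. -/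
def finiteTheta (p x : ℂ) (N : ℕ) : ℂ :=
  ∑' k : ℤ, thetaCoeff p x k * invPoch p (N - k) * invPoch p (N + k)

theorem summable_finiteTheta (p x : ℂ) (a b : ℤ) :
    Summable fun k : ℤ => thetaCoeff p x k * invPoch p (a - k) * invPoch p (b + k) := by
  refine summable_of_ne_finset_zero (s := Icc (-b) a) fun k hk => ?_
  rw [mem_Icc, not_and_or] at hk
  rcases hk with hk | hk
  · rw [invPoch_of_neg p (n := b + k) (by omega), mul_zero]
  · rw [invPoch_of_neg p (n := a - k) (by omega), mul_zero, zero_mul]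

theorem finiteTheta_succ {p x y : ℂ} (hp1 : ‖p‖ < 1) (hp : p ≠ 0) (hxy : x * y = p) (N : ℕ) :
    finiteTheta p x (N + 1) * ((1 - p ^ (2 * N + 1)) * (1 - p ^ (2 * N + 2))) =
      finiteTheta p x N * ((1 - x * p ^ N) * (1 - y * p ^ N)) := by
  have hx : x ≠ 0 := left_ne_zero_of_mul (hxy ▸ hp)
  have s0 : HasSum _ (finiteTheta p x N) := (summable_finiteTheta p x N N).hasSum
  have s1 : HasSum _ (finiteTheta p x (N + 1)) :=
    (summable_finiteTheta p x (N + 1 : ℕ) (N + 1 : ℕ)).hasSum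
  -- Multiplication by `x` or `y` amounts to shifting `k`, so both multiples become series in the
  -- same coefficients and the recurrence can be checked term by term.
  have hX : HasSum (fun k : ℤ => -(p ^ (1 - k)) *
      (thetaCoeff p x k * invPoch p (N + 1 - k) * invPoch p (N - 1 + k)))
      (x * finiteTheta p x N) := by
    rw [← (Equiv.addRight (1 : ℤ)).hasSum_iff]
    refine (s0.mul_left x).congr_fun fun k => ?_
    simp only [Function.comp_apply, Equiv.coe_addRight]
    rw [thetaCoeff_add_one hp hx, show (1 : ℤ) - (k + 1) = -k by ring, zpow_neg,
      show (N : ℤ) + 1 - (k + 1) = N - k by ring, show (N : ℤ) - 1 + (k + 1) = N + k by ring]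
    have := zpow_ne_zero k hp
    field_simp
  have hY : HasSum (fun k : ℤ => -(p ^ (k + 1)) *
      (thetaCoeff p x k * invPoch p (N - 1 - k) * invPoch p (N + 1 + k)))
      (y * finiteTheta p x N) := by
    refine ((Equiv.addRight (1 : ℤ)).hasSum_iff.2 (s0.mul_left y)).congr_fun fun k => ?_
    simp only [Function.comp_apply, Equiv.coe_addRight]
    rw [thetaCoeff_add_one hp hx, zpow_add_one₀ hp,
      show (N : ℤ) - (k + 1) = N - 1 - k by ring, show (N : ℤ) + (k + 1) = N + 1 + k by ring]
    linear_combination (p ^ k * (thetaCoeff p x k * invPoch p (N - 1 - k) *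
      invPoch p (N + 1 + k))) * hxy
  -- Since `xy = p`, the product `(1 - x p^N)(1 - y p^N)` is `1 + p^{2N+1} - p^N (x + y)`.
  have key := (s0.mul_left (1 + p ^ (2 * N + 1))).sub ((hX.add hY).mul_left (p ^ N))
  have hterm := (s1.mul_right ((1 - p ^ (2 * N + 1)) * (1 - p ^ (2 * N + 2)))).unique
    (key.congr_fun fun k => ?_)
  · rw [hterm]
    linear_combination (-(p ^ (2 * N)) * finiteTheta p x N) * hxy
  · have h1 := invPoch_sub_one hp1 (N + 1 - k)
    have h2 := invPoch_sub_one hp1 (N + 1 + k)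
    have h3 := invPoch_sub_one hp1 (N - k)
    have h4 := invPoch_sub_one hp1 (N + k)
    rw [show (N : ℤ) + 1 - k - 1 = N - k by ring] at h1
    rw [show (N : ℤ) + 1 + k - 1 = N + k by ring] at h2
    rw [show (N : ℤ) - k - 1 = N - 1 - k by ring] at h3
    rw [show (N : ℤ) + k - 1 = N - 1 + k by ring] at h4
    push_cast
    rw [h3, h4, h1, h2]
    have hu := zpow_ne_zero k hp
    simp only [zpow_add₀ hp, zpow_sub₀ hp, zpow_natCast, zpow_one]
    field_simp
    ring

theorem finiteTheta_zero (p x : ℂ) : finiteTheta p x 0 = 1 := by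
  rw [finiteTheta, tsum_eq_single 0]
  · simp [thetaCoeff, invPoch, qPoch]
  · intro k hk
    rcases lt_or_gt_of_ne hk with h | h
    · rw [invPoch_of_neg p (n := _ + k) (by simpa using h), mul_zero]
    · rw [invPoch_of_neg p (n := _ - k) (by simpa using h), mul_zero, zero_mul]

/-- A finite form of the triple product; letting `N → ∞` gives the full identity. -/
theorem finiteTheta_mul_qPoch {p x y : ℂ} (hp1 : ‖p‖ < 1) (hp : p ≠ 0) (hxy : x * y = p) (N : ℕ) :
    finiteTheta p x N * qPoch p p (2 * N) = qPoch x p N * qPoch y p N := by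
  induction N with
  | zero => simp [finiteTheta_zero, qPoch]
  | succ N ih =>
    have h := finiteTheta_succ hp1 hp hxy N
    rw [show 2 * (N + 1) = 2 * N + 1 + 1 by ring, qPoch_succ, qPoch_succ, qPoch_succ, qPoch_succ]
    linear_combination qPoch p p (2 * N) * h + (1 - x * p ^ N) * (1 - y * p ^ N) * ih

/-- The **Jacobi triple product** identity. -/
theorem tsum_thetaCoeff {p x y : ℂ} (hp1 : ‖p‖ < 1) (hp : p ≠ 0) (hxy : x * y = p) :
    ∑' k : ℤ, thetaCoeff p x k = qPochInf₃ x y p p := by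
  obtain ⟨B, -, hB⟩ := exists_norm_invPoch_le hp1
  have hne := qPochInf_self_ne_zero hp1
  have hlim : Tendsto (finiteTheta p x) atTop
      (𝓝 (∑' k : ℤ, thetaCoeff p x k * (qPochInf p p)⁻¹ * (qPochInf p p)⁻¹)) := by
    refine tendsto_tsum_of_dominated_convergence
      ((summable_thetaCoeff hp1 hp hxy).mul_right (B * B)) (fun k => ?_)
      (.of_forall fun N k => norm_mul_mul_le le_rfl (hB _) (hB _))
    refine (tendsto_const_nhds.mul ((tendsto_invPoch hp1).comp ?_)).mul
      ((tendsto_invPoch hp1).comp ?_)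
    · simpa only [sub_eq_add_neg] using
        tendsto_atTop_add_const_right _ (-k) tendsto_natCast_atTop_atTop
    · exact tendsto_atTop_add_const_right _ k tendsto_natCast_atTop_atTop
  rw [tsum_mul_right, tsum_mul_right] at hlim
  have h2 : Tendsto (fun N => qPoch p p (2 * N)) atTop (𝓝 (qPochInf p p)) :=
    (tendsto_qPoch p hp1).comp (tendsto_id.const_mul_atTop' two_pos)
  have h := tendsto_nhds_unique ((hlim.mul h2).congr fun N => finiteTheta_mul_qPoch hp1 hp hxy N)
    ((tendsto_qPoch x hp1).mul (tendsto_qPoch y hp1))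
  rw [qPochInf₃, ← h]
  field_simp


/-! ### The inner sum for fixed `n` -/

/-- The partial sums `(-1)^M q^{M(M+1)/2}`, which telescope the coefficients
`(-1)^m q^{m(m-1)/2} (1 + q^m)`. -/
def signedTriangular (q : ℂ) (M : ℕ) : ℂ := (-1) ^ M * q ^ (M + 1).choose 2

theorem cast_choose_two_mul_two (k : ℕ) : (((k + 1).choose 2 : ℕ) : ℤ) * 2 = (k + 1) * k := by
  have := Nat.choose_two_right (k + 1)
  have h2 : 2 ∣ (k + 1) * (k + 1 - 1) := (Nat.even_mul_pred_self _).two_dvd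
  rw [this, Nat.add_sub_cancel] at *
  zify at h2 ⊢
  exact Int.ediv_mul_cancel h2

theorem signedTriangular_succ (q : ℂ) (M : ℕ) :
    signedTriangular q (M + 1) - signedTriangular q M =
      (-1) ^ (M + 1) * q ^ (M + 1).choose 2 * (1 + q ^ (M + 1)) := by
  rw [signedTriangular, signedTriangular, Nat.choose_succ_succ' (M + 1) 1, Nat.choose_one_right,
    pow_add q]
  ring

/-- The kernel whose difference in `s` is `kernelDiff`. -/
def kernel (q : ℂ) (n s : ℕ) : ℂ :=
  q ^ s.choose 2 * (1 + q ^ s) / (1 + q ^ n) * invPoch q (n - s) * invPoch q (n + s)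

/-- The difference of consecutive values of `kernel`. -/
def kernelDiff (q : ℂ) (n r : ℕ) : ℂ :=
  q ^ r.choose 2 * (1 - q ^ (2 * r + 1)) * invPoch q (n - r) * invPoch q (n + r + 1)

theorem kernel_sub_kernel_succ {q : ℂ} (hq : ‖q‖ < 1) (hq0 : q ≠ 0) {n : ℕ} (hn : n ≠ 0) (r : ℕ) :
    kernel q n r - kernel q n (r + 1) = kernelDiff q n r := by
  have h1 := invPoch_sub_one hq (n - r)
  have h2 := invPoch_sub_one hq (n + r + 1)
  have hne := one_add_pow_ne_zero hq hn
  rw [show (n : ℤ) - r - 1 = n - (r + 1 : ℕ) by push_cast; ring] at h1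
  rw [add_sub_cancel_right] at h2
  rw [kernel, kernel, kernelDiff, h1, h2, Nat.choose_succ_succ' r 1, Nat.choose_one_right, pow_add q]
  push_cast
  rw [← add_assoc]
  simp only [zpow_add₀ hq0, zpow_sub₀ hq0, zpow_natCast, zpow_one]
  field_simp
  ring

theorem kernel_eq_zero (q : ℂ) {n s : ℕ} (h : n < s) : kernel q n s = 0 := by
  rw [kernel, invPoch_of_neg q (n := n - s) (by omega), mul_zero, zero_mul]

theorem kernelDiff_eq_zero (q : ℂ) {n s : ℕ} (h : n < s) : kernelDiff q n s = 0 := by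
  rw [kernelDiff, invPoch_of_neg q (n := n - s) (by omega), mul_zero, zero_mul]

theorem qBinom_eq {q : ℂ} (n : ℕ) (k : ℤ) :
    qBinom q n k = qPoch q q n * invPoch q k * invPoch q (n - k) := by
  unfold qBinom
  split_ifs with h
  · obtain ⟨j, rfl⟩ := Int.eq_ofNat_of_zero_le h.1
    have hj : j ≤ n := by omega
    rw [Int.toNat_natCast, ← Nat.cast_sub hj, invPoch_natCast, invPoch_natCast, div_eq_mul_inv,
      mul_inv, mul_assoc]
  · rw [not_and_or] at h
    rcases h with h | h
    · rw [invPoch_of_neg q (n := k) (by omega), mul_zero, zero_mul]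
    · rw [invPoch_of_neg q (n := n - k) (by omega), mul_zero]

/-- Here `(q)_{2n-1} / (q)_{2n} = 1 / (1 - q^{2n})`; the remaining reciprocals vanish outside the
stated range of `m`. -/
theorem doubleSumTerm_eq {q : ℂ} (hq : ‖q‖ < 1) (n : ℕ+) (m : ℤ) :
    doubleSumTerm q n m =
      (-1) ^ m * q ^ ((n : ℤ) * (n + 1) + m * (5 * m - 3) / 2) * (1 + q ^ m) / (1 - q ^ (2 * (n : ℕ)))
        * invPoch q (n - 2 * m) * invPoch q (n + 2 * m - 1) := by
  obtain ⟨k, hk⟩ : ∃ k, 2 * (n : ℕ) = k + 1 := ⟨2 * n - 1, by have := n.pos; omega⟩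
  have hk' : (k : ℤ) = 2 * (n : ℕ) - 1 := by omega
  have h1 : (k : ℤ) - ((n : ℕ) - 2 * m) = (n : ℕ) + 2 * m - 1 := by omega
  have h2 := one_sub_pow_ne_zero hq k.succ_ne_zero
  have h3 := qPoch_self_ne_zero hq k
  rw [doubleSumTerm, qBinom_eq, hk, Nat.add_sub_cancel, h1, qPoch_succ, ← pow_succ']
  field_simp

theorem doubleSumTerm_zero {q : ℂ} (hq : ‖q‖ < 1) (hq0 : q ≠ 0) (n : ℕ+) :
    doubleSumTerm q n 0 = q ^ ((n : ℕ) ^ 2 + n) * kernel q n 0 := by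
  have h := invPoch_sub_one hq n
  have h1 := one_add_pow_ne_zero hq n.ne_zero
  have h2 := one_sub_pow_ne_zero hq n.ne_zero
  have h3 : 1 - q ^ (2 * (n : ℕ)) = (1 - q ^ (n : ℕ)) * (1 + q ^ (n : ℕ)) := by ring
  have h4 : (n : ℤ) * (n + 1) + 0 = ((n : ℕ) ^ 2 + n : ℕ) := by push_cast; ring
  rw [doubleSumTerm_eq hq, h3, kernel]
  simp only [mul_zero, zero_mul, Int.zero_ediv, h4, zpow_natCast, add_zero, sub_zero, h, zpow_zero]
  simp
  field_simp

/-- With `u = q^{K+1}`, the pair contributes `(1+u)((1 - q^n u²) + (u² - q^n)) = (1+u)(1+u²)(1 -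
q^n)`. The factor `1 - q^n` cancels against `1 - q^{2n}`, `1+u` goes to the triangular difference
and `1+u²` to the kernel. -/
theorem doubleSumTerm_add_neg {q : ℂ} (hq : ‖q‖ < 1) (hq0 : q ≠ 0) (n : ℕ+) (K : ℕ) :
    doubleSumTerm q n (K + 1) + doubleSumTerm q n (-(K + 1)) = q ^ ((n : ℕ) ^ 2 + n) *
      ((signedTriangular q (K + 1) - signedTriangular q K) * kernel q n (2 * K + 2)) := by
  have h1 := one_add_pow_ne_zero hq n.ne_zero
  have h2 := one_sub_pow_ne_zero hq n.ne_zero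
  have h3 : 1 - q ^ (2 * (n : ℕ)) = (1 - q ^ (n : ℕ)) * (1 + q ^ (n : ℕ)) := by ring
  have c1 := cast_choose_two_mul_two K
  have c2 := cast_choose_two_mul_two (2 * K + 1)
  -- The exponent splits as `m(5m-3)/2 = C(m,2) + C(2m,2)` with `m = K + 1`; replacing `m` by `-m`
  -- adds `3m`.
  have e1 : (n : ℤ) * (n + 1) + (K + 1) * (5 * (K + 1) - 3) / 2 =
      ((n : ℕ) ^ 2 + n + (K + 1).choose 2 + (2 * K + 1 + 1).choose 2 : ℕ) := by
    have : ((K : ℤ) + 1) * (5 * (K + 1) - 3) / 2 =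
        (K + 1).choose 2 + (2 * K + 1 + 1).choose 2 := by
      refine Int.ediv_eq_of_eq_mul_right two_ne_zero ?_
      push_cast at c2
      linarith
    rw [this]; push_cast; ring
  have e2 : (n : ℤ) * (n + 1) + -(K + 1) * (5 * -(K + 1) - 3) / 2 =
      ((n : ℕ) ^ 2 + n + (K + 1).choose 2 + (2 * K + 1 + 1).choose 2 + 3 * (K + 1) : ℕ) := by
    have : -((K : ℤ) + 1) * (5 * -(K + 1) - 3) / 2 =
        (K + 1).choose 2 + (2 * K + 1 + 1).choose 2 + 3 * (K + 1) := by
      refine Int.ediv_eq_of_eq_mul_right two_ne_zero ?_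
      push_cast at c2
      linarith
    rw [this]; push_cast; ring
  have r1 := invPoch_sub_one hq ((n : ℤ) + 2 * (K + 1))
  have r2 := invPoch_sub_one hq ((n : ℤ) - 2 * (K + 1))
  have hs : ((-1 : ℂ)) ^ (-((K : ℤ) + 1)) = (-1) ^ (K + 1) := by
    rw [← inv_zpow']; norm_num; exact_mod_cast zpow_natCast (-1 : ℂ) (K + 1)
  have hs' : ((-1 : ℂ)) ^ ((K : ℤ) + 1) = (-1) ^ (K + 1) := by exact_mod_cast zpow_natCast (-1 : ℂ) (K + 1)
  have hqk : q ^ ((K : ℤ) + 1) = q ^ (K + 1) := by exact_mod_cast zpow_natCast q (K + 1)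
  have hz1 : q ^ ((n : ℤ) + 2 * (K + 1)) = q ^ (n : ℕ) * (q ^ (K + 1)) ^ 2 := by
    rw [zpow_add₀ hq0, zpow_mul', ← hqk]; simp
  have hz2 : q ^ ((n : ℤ) - 2 * (K + 1)) = q ^ (n : ℕ) / (q ^ (K + 1)) ^ 2 := by
    rw [zpow_sub₀ hq0, zpow_mul', ← hqk]; simp
  have hne := pow_ne_zero (K + 1) hq0
  rw [doubleSumTerm_eq hq, doubleSumTerm_eq hq, e1, e2, hs, hs', signedTriangular_succ, kernel, h3,
    zpow_natCast, zpow_natCast, zpow_neg, hqk, r1, hz1,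
    show (n : ℤ) - 2 * -(K + 1) = n + 2 * (K + 1) by ring,
    show (n : ℤ) + 2 * -(K + 1) - 1 = n - 2 * (K + 1) - 1 by ring, r2, hz2,
    show ((2 * K + 2 : ℕ) : ℤ) = 2 * (K + 1) by push_cast; ring,
    show 2 * K + 2 = 2 * (K + 1) by ring]
  rw [pow_add q _ (3 * (K + 1)), pow_add q _ ((2 * (K + 1)).choose 2), pow_add q _ ((K + 1).choose 2),
    pow_mul' q 3, pow_mul' q 2 (K + 1)]
  generalize q ^ (K + 1) = u at *
  field_simp
  ring

theorem sum_Icc_neg_succ (f : ℤ → ℂ) (K : ℕ) :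
    ∑ m ∈ Icc (-((K + 1 : ℕ) : ℤ)) (K + 1 : ℕ), f m =
      ∑ m ∈ Icc (-(K : ℤ)) K, f m + (f (K + 1) + f (-(K + 1))) := by
  have h : Icc (-((K + 1 : ℕ) : ℤ)) (K + 1 : ℕ) =
      insert ((K : ℤ) + 1) (insert (-((K : ℤ) + 1)) (Icc (-(K : ℤ)) K)) := by
    ext m
    simp only [mem_Icc, mem_insert]
    omega
  rw [h, sum_insert (by simp; omega), sum_insert (by simp)]
  ring

/-- Summation by parts: the kernel is sampled at even `s` only, so each `T_M` multiplies the two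
differences `r = 2M` and `r = 2M + 1`. -/
theorem sum_doubleSumTerm_symm {q : ℂ} (hq : ‖q‖ < 1) (hq0 : q ≠ 0) (n : ℕ+) (K : ℕ) :
    ∑ m ∈ Icc (-(K : ℤ)) K, doubleSumTerm q n m = q ^ ((n : ℕ) ^ 2 + n) *
      (∑ r ∈ range (2 * K + 2), signedTriangular q (r / 2) * kernelDiff q n r
        + signedTriangular q K * kernel q n (2 * K + 2)) := by
  have hk := kernel_sub_kernel_succ hq hq0 n.ne_zero
  induction K with
  | zero =>
    simp [doubleSumTerm_zero hq hq0, sum_range_succ, ← hk, signedTriangular]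
  | succ K ih =>
    have d1 : (2 * K + 2) / 2 = K + 1 := by omega
    have d2 : (2 * K + 2 + 1) / 2 = K + 1 := by omega
    rw [sum_Icc_neg_succ, ih, doubleSumTerm_add_neg hq hq0, show 2 * (K + 1) + 2 = 2 * K + 2 + 1 + 1 by ring,
      sum_range_succ _ (2 * K + 2 + 1), sum_range_succ _ (2 * K + 2), d1, d2, ← hk, ← hk]
    ring

theorem sum_doubleSumTerm {q : ℂ} (hq : ‖q‖ < 1) (hq0 : q ≠ 0) (n : ℕ+) :
    ∑ m ∈ Icc (-(((n : ℤ) - 1) / 2)) ((n : ℤ) / 2), doubleSumTerm q n m = q ^ ((n : ℕ) ^ 2 + n) *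
      ∑ r ∈ range (n + 1), signedTriangular q (r / 2) * kernelDiff q n r := by
  have hn : 0 < (n : ℤ) := by exact_mod_cast n.pos
  -- Widening to `|m| ≤ n` adds only zero terms, and the boundary kernel at `2n + 2` vanishes.
  have hsub : Icc (-(((n : ℤ) - 1) / 2)) ((n : ℤ) / 2) ⊆ Icc (-((n : ℕ) : ℤ)) (n : ℕ) :=
    Icc_subset_Icc (by omega) (by omega)
  rw [sum_subset hsub, sum_doubleSumTerm_symm hq hq0, kernel_eq_zero q (by omega), mul_zero, add_zero]
  · congr 1
    refine (sum_subset (range_subset_range.2 (by omega)) fun r _ hr => ?_).symm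
    rw [kernelDiff_eq_zero q (by simpa using hr), mul_zero]
  · intro m _ hm
    rw [mem_Icc, not_and_or] at hm
    rw [doubleSumTerm_eq hq]
    rcases hm with hm | hm
    · rw [invPoch_of_neg q (n := n + 2 * m - 1) (by omega), mul_zero]
    · rw [invPoch_of_neg q (n := n - 2 * m) (by omega), mul_zero, zero_mul]


/-! ### Summation over `n` and the theta series -/

/-- The coefficients of the single series obtained after summing over `n`. -/
def seriesCoeff (q : ℂ) (r : ℕ) : ℂ :=
  signedTriangular q (r / 2) * q ^ (r ^ 2 + r + r.choose 2) * (1 - q ^ (2 * r + 1))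

theorem norm_seriesCoeff_le {q : ℂ} (hq : ‖q‖ < 1) (r : ℕ) :
    ‖seriesCoeff q r‖ ≤ ‖q‖ ^ r * 2 := by
  have h1 : ‖signedTriangular q (r / 2)‖ ≤ 1 := by
    simpa [signedTriangular] using pow_le_one₀ (norm_nonneg q) hq.le
  have h2 : ‖q ^ (r ^ 2 + r + r.choose 2)‖ ≤ ‖q‖ ^ r := norm_pow_le_norm_pow hq (by omega)
  have h3 : ‖1 - q ^ (2 * r + 1)‖ ≤ 2 := by
    refine (norm_sub_le _ _).trans ?_
    have := norm_pow_le_norm_pow hq (Nat.zero_le (2 * r + 1))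
    rw [norm_one]; linarith [pow_zero ‖q‖]
  rw [seriesCoeff, norm_mul, norm_mul]
  calc _ ≤ 1 * ‖q‖ ^ r * 2 := by gcongr
    _ = _ := by ring

theorem summable_seriesCoeff {q : ℂ} (hq : ‖q‖ < 1) : Summable (seriesCoeff q) :=
  .of_norm_bounded (summable_norm_pow_mul hq 2) (norm_seriesCoeff_le hq)

/-- The `n`-th term of the outer series, including `n = 0`. -/
def outerTerm (q : ℂ) (n : ℕ) : ℂ :=
  q ^ (n ^ 2 + n) * ∑ r ∈ range (n + 1), signedTriangular q (r / 2) * kernelDiff q n r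

theorem outerTerm_zero {q : ℂ} (hq : ‖q‖ < 1) : outerTerm q 0 = 1 := by
  have := one_sub_pow_ne_zero hq one_ne_zero
  rw [pow_one] at this
  simp [outerTerm, kernelDiff, signedTriangular, invPoch, qPoch, this]

/-- The terms of the outer series, indexed by `r` and `n - r`. -/
def reindexedTerm (q : ℂ) (x : ℕ × ℕ) : ℂ :=
  seriesCoeff q x.1 * (q ^ (x.2 ^ 2 + (2 * x.1 + 1) * x.2) * invPoch q x.2
    * invPoch q (x.2 + (2 * x.1 + 1 : ℕ)))

theorem outerTerm_eq_sum_antidiagonal (q : ℂ) (n : ℕ) :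
    outerTerm q n = ∑ x ∈ antidiagonal n, reindexedTerm q x := by
  simp only [reindexedTerm]
  rw [Finset.Nat.sum_antidiagonal_eq_sum_range_succ (fun r k : ℕ => seriesCoeff q r *
      (q ^ (k ^ 2 + (2 * r + 1) * k) * invPoch q k * invPoch q (k + (2 * r + 1 : ℕ)))),
    outerTerm, mul_sum]
  refine sum_congr rfl fun r hr => ?_
  obtain ⟨k, rfl⟩ := Nat.exists_eq_add_of_le (Nat.lt_succ_iff.1 (mem_range.1 hr))
  rw [Nat.add_sub_cancel_left, kernelDiff, seriesCoeff]
  push_cast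
  rw [show (r : ℤ) + k - r = k by ring, show (r : ℤ) + k + r + 1 = k + (2 * r + 1) by ring]
  ring

theorem hasSum_cauchySum {q : ℂ} (hq : ‖q‖ < 1) (c : ℕ) :
    HasSum (fun k : ℕ => q ^ (k ^ 2 + c * k) * invPoch q k * invPoch q (k + c))
      (qPochInf q q)⁻¹ := by
  rw [← cauchySum_eq hq c]
  exact (summable_cauchySum hq c).hasSum

/-- The double series over `(r, k)` converges absolutely, so summing along rows (Cauchy's identity)
and along antidiagonals `r + k = n` gives the same value. -/
theorem hasSum_outerTerm {q : ℂ} (hq : ‖q‖ < 1) :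
    HasSum (outerTerm q) ((∑' r, seriesCoeff q r) * (qPochInf q q)⁻¹) := by
  obtain ⟨B, -, hB⟩ := exists_norm_invPoch_le hq
  have hs : Summable (reindexedTerm q) := by
    have hsum := (summable_norm_pow_mul hq 2).mul_of_nonneg (summable_norm_pow_mul hq (B * B))
      (fun k => by positivity) (fun k => mul_nonneg (by positivity) (mul_self_nonneg B))
    refine .of_norm_bounded hsum fun x => (norm_mul_le _ _).trans ?_
    exact mul_le_mul (norm_seriesCoeff_le hq x.1) (norm_cauchySum_term_le hq hB (2 * x.1 + 1) x.2)
      (norm_nonneg _) (by positivity)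
  have hrow : HasSum (fun r => seriesCoeff q r * (qPochInf q q)⁻¹) (∑' x, reindexedTerm q x) := by
    refine hs.hasSum.prod_fiberwise fun r => ?_
    simp only [reindexedTerm]
    exact (hasSum_cauchySum hq (2 * r + 1)).mul_left (seriesCoeff q r)
  have htotal : ∑' x, reindexedTerm q x = (∑' r, seriesCoeff q r) * (qPochInf q q)⁻¹ :=
    hrow.unique ((summable_seriesCoeff hq).hasSum.mul_right _)
  rw [← htotal]
  refine ((HasAntidiagonal.sigmaAntidiagonalEquivProd.hasSum_iff.2 hs.hasSum).sigma
    (g := outerTerm q) fun n => ?_)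
  rw [outerTerm_eq_sum_antidiagonal]
  exact (antidiagonal n).hasSum (reindexedTerm q)

theorem thetaCoeff_natCast (p x : ℂ) (n : ℕ) :
    thetaCoeff p x n = (-1) ^ n * p ^ n.choose 2 * x ^ n := by
  cases n with
  | zero => simp [thetaCoeff]
  | succ k =>
    have h : ((k + 1 : ℕ) : ℤ) * ((k + 1 : ℕ) - 1) / 2 = ((k + 1).choose 2 : ℕ) := by
      refine Int.ediv_eq_of_eq_mul_left two_ne_zero ?_
      rw [cast_choose_two_mul_two]
      push_cast; ring
    rw [thetaCoeff, h, zpow_natCast, zpow_natCast, zpow_natCast]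

/-- Even `r = 2M` supplies index `M` of both theta series, odd `r = 2M + 1` supplies index `-(M+1)`;
the two halves of `1 - q^{2r+1}` go to different series. -/
theorem sum_seriesCoeff_eq (q : ℂ) (M : ℕ) :
    seriesCoeff q (2 * M) + seriesCoeff q (2 * M + 1) =
      (-1) ^ M * (q ^ 13) ^ M.choose 2 * (q ^ 8) ^ M
      + (-1) ^ (M + 1) * (q ^ 13) ^ (M + 1).choose 2 * (q ^ 5) ^ (M + 1)
      - q * ((-1) ^ M * (q ^ 13) ^ M.choose 2 * (q ^ 12) ^ M
      + (-1) ^ (M + 1) * (q ^ 13) ^ (M + 1).choose 2 * q ^ (M + 1)) := by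
  have c0 : (M + 1).choose 2 = M.choose 2 + M := by
    rw [Nat.choose_succ_succ' M 1, Nat.choose_one_right, add_comm]
  have c1 := cast_choose_two_mul_two M
  have c2 := cast_choose_two_mul_two (2 * M)
  have c3 : (2 * M + 1).choose 2 = (2 * M).choose 2 + 2 * M := by
    rw [Nat.choose_succ_succ' (2 * M) 1, Nat.choose_one_right, add_comm]
  rw [c0] at c1
  rw [c3] at c2
  push_cast at c1 c2
  have d2 : (2 * M + 1) / 2 = M := by omega
  have e1 : (2 * M) ^ 2 + 2 * M + (2 * M).choose 2 = 12 * M.choose 2 + 7 * M := by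
    zify; linarith
  have e2 : (2 * M + 1) ^ 2 + (2 * M + 1) + (2 * M + 1).choose 2 = 12 * M.choose 2 + 13 * M + 2 := by
    rw [c3]; zify; linarith
  rw [seriesCoeff, seriesCoeff, e1, e2, d2, Nat.mul_div_cancel_left M two_pos, signedTriangular, c0]
  ring

theorem tsum_seriesCoeff {q : ℂ} (hq : ‖q‖ < 1) (hq0 : q ≠ 0) :
    ∑' r, seriesCoeff q r =
      qPochInf₃ (q ^ 5) (q ^ 8) (q ^ 13) (q ^ 13) - q * qPochInf₃ q (q ^ 12) (q ^ 13) (q ^ 13) := by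
  have hp : q ^ 13 ≠ 0 := pow_ne_zero _ hq0
  have hp1 : ‖q ^ 13‖ < 1 := by
    rw [norm_pow]; exact pow_lt_one₀ (norm_nonneg q) hq (by norm_num)
  have key : ∀ x y : ℂ, x * y = q ^ 13 → HasSum (fun M : ℕ =>
      (-1) ^ M * (q ^ 13) ^ M.choose 2 * x ^ M
        + (-1) ^ (M + 1) * (q ^ 13) ^ (M + 1).choose 2 * y ^ (M + 1))
      (qPochInf₃ x y (q ^ 13) (q ^ 13)) := by
    intro x y hxy
    rw [← tsum_thetaCoeff hp1 hp hxy]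
    refine (summable_thetaCoeff hp1 hp hxy).of_norm.hasSum.nat_add_neg_add_one.congr_fun fun M => ?_
    have h := thetaCoeff_natCast (q ^ 13) y (M + 1)
    push_cast at h
    rw [thetaCoeff_neg hp hxy, h, thetaCoeff_natCast]
  have h8 := key (q ^ 8) (q ^ 5) (by ring)
  have h12 := key (q ^ 12) q (by ring)
  have hs := summable_seriesCoeff hq
  have he : Summable fun k => seriesCoeff q (2 * k) := hs.comp_injective (mul_right_injective₀ (two_ne_zero' ℕ))
  have ho : Summable fun k => seriesCoeff q (2 * k + 1) := hs.comp_injective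
    ((add_left_injective 1).comp (mul_right_injective₀ (two_ne_zero' ℕ)))
  rw [← tsum_even_add_odd he ho, ← Summable.tsum_add he ho]
  refine HasSum.tsum_eq ?_
  have hcomm : ∀ x y z : ℂ, qPochInf₃ x y z z = qPochInf₃ y x z z := fun x y z => by
    simp only [qPochInf₃]
    ring
  rw [hcomm (q ^ 5), hcomm q]
  exact (h8.sub (h12.mul_left q)).congr_fun (sum_seriesCoeff_eq q)

theorem doubleSumTerm_zero_left (n : ℕ+) (m : ℤ) : doubleSumTerm 0 n m = 0 := by
  have hn : 0 < (n : ℤ) := by exact_mod_cast n.pos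
  have hm : 0 ≤ m * (5 * m - 3) / 2 := by
    refine Int.ediv_nonneg ?_ (by norm_num)
    rcases le_or_gt m 0 with h | h <;> nlinarith
  rw [doubleSumTerm, zero_zpow _ (by positivity)]
  simp

theorem mainTheorem11 (q : ℂ) (hq : ‖q‖ < 1) :
    (Summable fun n : ℕ+ =>
      ∑ m ∈ Finset.Icc (-(((n : ℤ) - 1) / 2)) ((n : ℤ) / 2), doubleSumTerm q n m) ∧
    1 + ∑' n : ℕ+, ∑ m ∈ Finset.Icc (-(((n : ℤ) - 1) / 2)) ((n : ℤ) / 2), doubleSumTerm q n m =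
      1 / qPochInf q q *
        (qPochInf₃ (q ^ 5) (q ^ 8) (q ^ 13) (q ^ 13)
          - q * qPochInf₃ q (q ^ 12) (q ^ 13) (q ^ 13)) := by
  -- Negative powers of `q` require `q ≠ 0`. At `q = 0` all exponents `n(n+1) + m(5m-3)/2` are
  -- positive, so every summand is zero.
  rcases eq_or_ne q 0 with rfl | hq0
  · simp [doubleSumTerm_zero_left, summable_zero, qPochInf₃, qPochInf]
  · have h := hasSum_outerTerm hq
    simp only [sum_doubleSumTerm hq hq0]
    change (Summable fun n : ℕ+ => outerTerm q n) ∧ 1 + ∑' n : ℕ+, outerTerm q n = _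
    refine ⟨h.summable.comp_injective PNat.coe_injective, ?_⟩
    -- The leading `1` is the `n = 0` term of the outer series.
    have h0 := tsum_zero_pnat_eq_tsum_nat h.summable
    rw [outerTerm_zero hq, h.tsum_eq, tsum_seriesCoeff hq hq0] at h0
    rw [h0]
    ring

end
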